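/- Let $\Omega$ be the set of all functions $\omega:[0,\infty)\to[0,\infty]$ that are absorbed in $0$ and in $\infty$ (once at $0$ or at $\infty$, they stay there) and that are continuous on $[0,T_\infty(\omega))$, where $T_\infty(\omega)$ is the first hitting time of $\infty$ (defined below); if $T_\infty(\omega)<\infty$, then $\omega(T_\infty(\omega))=\infty$. Let $X_t(\omega)=\omega(t)$ be the coordinate process, $\mathcal F_t=\sigma(X_s:s\le t)$, $\mathcal F=\bigvee_{t\ge0}\mathcal F_t$, and $$X_\infty:=\sqrt{\limsup_{t\uparrow\infty}X_t\cdot\liminf_{t\uparrow\infty}X_t},\qquad \infty\cdot 0:=1.$$ For $a\in[0,\infty]$ let $T_a=\inf\{t\in[0,\infty]:X_t=a\}$ with $\inf\emptyset:=\mathfrak T$, where $\mathfrak T$ is an additional time with $t<\mathfrak T$ for all $t\in[0,\infty]$. For a stopping time $\tau$ of $(\mathcal F_t)_{t\ge0}$ (with values in $[0,\infty]$) let $X^\tau$ be $X$ stopped at $\tau$, let $X_\tau$ be the value of $X$ at $\tau$ (equal to $X_\infty$ where $\tau=\infty$), and let $\mathcal F_\tau=\{A\in\mathcal F: A\cap\{\tau\le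 t\}\in\mathcal F_t\ \forall t\in[0,\infty)\}$. Let $P$ be a probability measure on $(\Omega,\mathcal F)$ under which $X$ is a nonnegative local martingale with respect to $(\mathcal F_t)_{t\ge 0}$ and $P(X_0=1)=1$. Let $Q$ be the $h$-transform (Föllmer measure) of $P$, that is, the probability measure on $(\Omega,\mathcal F)$ such that $\mathrm dQ|_{\mathcal F_\tau}=X_\tau\,\mathrm dP|_{\mathcal F_\tau}$ for all stopping times $\tau$ for which $X^\tau$ is a uniformly integrable martingale under $P$. Then, under $Q$, the process $1/X$ (with $1/0=\infty$, $1/\infty=0$) is a nonnegative local martingale with respect to $(\mathcal F_t)_{t\ge0}$; in particular it is $Q$-almost surely finite at all times. Moreover, $Q(T_\infty=\mathfrak T)=E_P[X_\infty]$. -/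

import Mathlib

open MeasureTheory ProbabilityTheory Filter Set
open scoped NNReal ENNReal Topology

noncomputable section

namespace HTransform

/-! ### Paths and hitting times

Times in `[0, ∞]` are elements of `WithTop ℝ≥0`; times in `[0, ∞] ∪ {𝔗}` are elements of
`WithTop (WithTop ℝ≥0)`, whose outer `⊤` is the time `𝔗` beyond infinity. -/

/-- The terminal value `√(limsup_{t → ∞} ω t * liminf_{t → ∞} ω t)`, where `∞ * 0 := 1`. -/
def terminalValue (ω : ℝ≥0 → ℝ≥0∞) : ℝ≥0∞ :=
  open Classical in
  if limsup ω atTop = ∞ ∧ liminf ω atTop = 0 then 1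
  else (limsup ω atTop * liminf ω atTop) ^ (1 / 2 : ℝ)

/-- The value of the path at a time in `[0, ∞]`. -/
def valueAt (ω : ℝ≥0 → ℝ≥0∞) : WithTop ℝ≥0 → ℝ≥0∞
  | (t : ℝ≥0) => ω t
  | ⊤ => terminalValue ω

/-- First hitting time of the level `a`: the infimum of all `t ∈ [0, ∞]` at which the path is
equal to `a`, and `𝔗 = ⊤` if there is no such `t`. -/
def hittingTime (a : ℝ≥0∞) (ω : ℝ≥0 → ℝ≥0∞) : WithTop (WithTop ℝ≥0) :=
  sInf ((fun t : WithTop ℝ≥0 => (t : WithTop (WithTop ℝ≥0))) '' {t | valueAt ω t = a})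

/-- `[0, ∞]`-valued functions on `[0, ∞)` that are absorbed in `0` and in `∞`, and that are
continuous on `[0, T_∞)`, where `T_∞` is the first hitting time of `∞`. -/
structure IsAbsorbedPath (ω : ℝ≥0 → ℝ≥0∞) : Prop where
  absorbed_zero : ∀ s t : ℝ≥0, s ≤ t → ω s = 0 → ω t = 0
  absorbed_top : ∀ s t : ℝ≥0, s ≤ t → ω s = ∞ → ω t = ∞
  continuousOn : ContinuousOn ω
    {t : ℝ≥0 | ((t : WithTop ℝ≥0) : WithTop (WithTop ℝ≥0)) < hittingTime ∞ ω}
  /-- A finite `T_∞` is a time at which the path is at `∞` (the infimum is attained). -/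
  hitting_attained : ∀ t : ℝ≥0,
    hittingTime ∞ ω = ((t : WithTop ℝ≥0) : WithTop (WithTop ℝ≥0)) → ω t = ∞

/-- The path space `C_abs`. It carries the σ-algebra generated by the coordinates. -/
abbrev PathSpace : Type := {ω : ℝ≥0 → ℝ≥0∞ // IsAbsorbedPath ω}

/-- The coordinate process. -/
def X (t : ℝ≥0) (ω : PathSpace) : ℝ≥0∞ := ω.1 t

/-- The terminal value of the coordinate process. -/
def XInfty (ω : PathSpace) : ℝ≥0∞ := terminalValue ω.1

/-- The first hitting time `T_a` of `a` by the coordinate process. -/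
def T (a : ℝ≥0∞) (ω : PathSpace) : WithTop (WithTop ℝ≥0) := hittingTime a ω.1

theorem stronglyMeasurable_X (t : ℝ≥0) : StronglyMeasurable (X t) :=
  ((measurable_pi_apply t).comp measurable_subtype_coe).stronglyMeasurable

/-- The canonical filtration `ℱ_t = σ(X_s : s ≤ t)`. -/
def canonicalFiltration : Filtration ℝ≥0 (inferInstance : MeasurableSpace PathSpace) :=
  Filtration.natural X stronglyMeasurable_X

/-- The value `X_τ` of the coordinate process at a random time, equal to `X_∞` where `τ = ∞`. -/
def XAt (τ : PathSpace → WithTop ℝ≥0) (ω : PathSpace) : ℝ≥0∞ := valueAt ω.1 (τ ω)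

/-! ### Nonnegative local martingales -/

/-- Right-continuous with (finite) left limits. -/
def IsCadlag (f : ℝ≥0 → ℝ) : Prop :=
  ∀ t, ContinuousWithinAt f (Ici t) t ∧ ∃ l : ℝ, Tendsto f (𝓝[<] t) (𝓝 l)

/-- A `[0, ∞]`-valued process is a nonnegative local martingale: almost surely it is finite at all
times and càdlàg, and it is locally (along a localizing sequence of stopping times) a
martingale. -/
structure IsNonnegLocalMartingale {Ω : Type*} {m : MeasurableSpace Ω} (Y : ℝ≥0 → Ω → ℝ≥0∞)
    (𝓕 : Filtration ℝ≥0 m) (μ : Measure Ω) : Prop where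
  finite : ∀ᵐ ω ∂μ, ∀ t, Y t ω ≠ ∞
  cadlag : ∀ᵐ ω ∂μ, IsCadlag (fun t => (Y t ω).toReal)
  locally_martingale :
    Locally (fun Z : ℝ≥0 → Ω → ℝ => Martingale Z 𝓕 μ) 𝓕 (fun t ω => (Y t ω).toReal) μ

/-! ### The h-transform -/

/-- The stopped coordinate process `X^τ` is a uniformly integrable martingale under `P`. -/
def IsUIMartingaleStopped (P : Measure PathSpace) (τ : PathSpace → WithTop ℝ≥0) : Prop :=
  Martingale (stoppedProcess (fun t ω => (X t ω).toReal) τ) canonicalFiltration P ∧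
    UniformIntegrable (stoppedProcess (fun t ω => (X t ω).toReal) τ) 1 P

/-- `Q` is an h-transform (Föllmer measure) of `P`: a probability measure with
`dQ|ℱ_τ = X_τ dP|ℱ_τ` for all stopping times `τ` for which `X^τ` is a uniformly integrable
`P`-martingale. A stopping time that takes the value `𝔗` may be replaced by its minimum with `∞`,
which changes neither `ℱ_τ`, nor `X^τ`, nor `X_τ`. -/
structure IsHTransform (P Q : Measure PathSpace) : Prop where
  isProbabilityMeasure : IsProbabilityMeasure Q
  density : ∀ (τ : PathSpace → WithTop ℝ≥0) (hτ : IsStoppingTime canonicalFiltration τ),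
    IsUIMartingaleStopped P τ →
      ∀ A : Set PathSpace, MeasurableSet[hτ.measurableSpace] A → Q A = ∫⁻ ω in A, XAt τ ω ∂P

end HTransform

end

/-! Up to the passage over a finite level, `X` is the density of `Q` relative to `P`: continuity
bounds the stopped process by the level `P`-almost surely, so it is a uniformly integrable
martingale (`isUIMartingaleStopped_of_le_upTime`) and the defining relation of `Q` applies.
Conversely `1 / X` is the density of `P` relative to `Q` wherever `X` is positive: the `Q`-integral
of `1 / X` at `min t κ` over an event `B` of the σ-algebra there is `P B`, whatever `t` is. Hence `1
/ X`, stopped on leaving `(a, n)`, is a bounded `Q`-martingale, and bounded convergence removes the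
level `n`. The maximal inequality `Q(X reaches [0, a]) ≤ a` makes the passages below `1 / (m + 1)` a
localizing sequence.

Admissible paths may jump to `∞` or oscillate before reaching it, so regularity of `1 / X` under `Q`
needs proof. There is no jump, because `P` does not charge infinite values of `X`. There is no
oscillation, because after passing level `n` the process returns below `k` with `Q`-probability at
most `k * P(level n is passed) ≤ k / n` (`apply_exists_le`).

The absence of returns also shows that, `Q`-almost surely, `T_∞ = 𝔗` exactly when some finite level
is never passed. On the event that a given level is never passed, the density of `Q` is `X_∞`; these
events increase to a set of full `P`-measure, and monotone convergence gives the formula. -/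

noncomputable section

namespace HTransform

/-! ### Rounding up times -/

/-- The smallest multiple of `1 / (j + 1)` which is strictly greater than `x`. -/
def roundUp (j : ℕ) (x : ℝ≥0) : ℝ≥0 := (⌊((j : ℝ≥0) + 1) * x⌋₊ + 1 : ℝ≥0) / ((j : ℝ≥0) + 1)

lemma lt_roundUp (j : ℕ) (x : ℝ≥0) : x < roundUp j x := by
  rw [roundUp, lt_div_iff₀ (by positivity), mul_comm]
  exact Nat.lt_floor_add_one _

lemma roundUp_le (j : ℕ) (x : ℝ≥0) : roundUp j x ≤ x + 1 / ((j : ℝ≥0) + 1) := by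
  rw [roundUp, add_div]
  gcongr
  rw [div_le_iff₀ (by positivity), mul_comm]
  exact Nat.floor_le (by positivity)

lemma roundUp_le_iff (j : ℕ) (x i : ℝ≥0) :
    roundUp j x ≤ i ↔ x < (⌊((j : ℝ≥0) + 1) * i⌋₊ : ℝ≥0) / ((j : ℝ≥0) + 1) := by
  have hj : (0 : ℝ≥0) < (j : ℝ≥0) + 1 := by positivity
  rw [roundUp, div_le_iff₀ hj, lt_div_iff₀ hj, mul_comm i, mul_comm x]
  rw [← Nat.floor_lt (by positivity), Nat.lt_iff_add_one_le, Nat.le_floor_iff (by positivity)]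
  norm_cast

lemma tendsto_roundUp (x : ℝ≥0) : Tendsto (fun j => roundUp j x) atTop (𝓝 x) := by
  have h1 : Tendsto (fun j : ℕ => x + 1 / ((j : ℝ≥0) + 1)) atTop (𝓝 (x + 0)) :=
    tendsto_const_nhds.add tendsto_one_div_add_atTop_nhds_zero_nat
  rw [add_zero] at h1
  exact tendsto_of_tendsto_of_tendsto_of_le_of_le tendsto_const_nhds h1
    (fun j => (lt_roundUp j x).le) (fun j => roundUp_le j x)

lemma countable_range_roundUp (j : ℕ) : (range (roundUp j)).Countable := by
  refine (countable_range fun n : ℕ => ((n : ℝ≥0) + 1) / ((j : ℝ≥0) + 1)).mono ?_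
  rintro _ ⟨x, rfl⟩
  exact ⟨_, rfl⟩

/-! ### Right-continuous processes -/

section General

variable {Ω : Type*} {m : MeasurableSpace Ω} {𝓕 : Filtration ℝ≥0 m} {μ : Measure Ω}

/-- Rounding time up to a grid and capping it at `i` gives jointly measurable approximations that
use only times up to `i`; right-continuity makes them converge. -/
lemma isStronglyProgressive_of_rightContinuous {β : Type*} [TopologicalSpace β]
    [TopologicalSpace.PseudoMetrizableSpace β] [SecondCountableTopology β]
    {u : ℝ≥0 → Ω → β} (hu : StronglyAdapted 𝓕 u)
    (hc : ∀ ω t, ContinuousWithinAt (fun s => u s ω) (Ici t) t) :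
    IsStronglyProgressive 𝓕 u := by
  intro i
  let : MeasurableSpace β := borel β
  have : BorelSpace β := ⟨rfl⟩
  let mi : MeasurableSpace Ω := 𝓕 i
  refine stronglyMeasurable_of_tendsto (u := atTop)
    (f := fun (j : ℕ) (p : Iic i × Ω) => u (min i (roundUp j p.1)) p.2) (fun j => ?_) ?_
  · have h1 : Measurable fun q : ℕ × Ω =>
        u (min i (((q.1 : ℝ≥0) + 1) / ((j : ℝ≥0) + 1))) q.2 := by
      refine measurable_from_prod_countable_right fun k => ?_
      exact ((hu (min i (((k : ℝ≥0) + 1) / ((j : ℝ≥0) + 1)))).mono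
        (𝓕.mono (min_le_left _ _))).measurable
    have h2 : Measurable fun p : Iic i × Ω => (⌊((j : ℝ≥0) + 1) * (p.1 : ℝ≥0)⌋₊, p.2) := by
      refine Measurable.prodMk ?_ measurable_snd
      exact Nat.measurable_floor.comp (by fun_prop)
    exact (h1.comp h2).stronglyMeasurable
  · rw [tendsto_pi_nhds]
    rintro ⟨⟨s, hs⟩, ω⟩
    refine (hc ω s).tendsto.comp (tendsto_nhdsWithin_iff.2 ⟨?_, Eventually.of_forall fun j => ?_⟩)
    · have := (tendsto_const_nhds (x := i)).min (tendsto_roundUp s)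
      rwa [min_eq_right (show s ≤ i from hs)] at this
    · exact le_min hs (lt_roundUp j s).le

lemma coe_untopA_min (t : ℝ≥0) (a : WithTop ℝ≥0) :
    (((min (t : WithTop ℝ≥0) a).untopA : ℝ≥0) : WithTop ℝ≥0) = min (t : WithTop ℝ≥0) a := by
  have h : min (t : WithTop ℝ≥0) a ≠ ⊤ :=
    ne_top_of_le_ne_top WithTop.coe_ne_top (min_le_left _ _)
  rw [WithTop.untopA_eq_untop h, WithTop.coe_untop]

lemma untopA_min_le (t : ℝ≥0) (a : WithTop ℝ≥0) : (min (t : WithTop ℝ≥0) a).untopA ≤ t := by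
  have := coe_untopA_min t a
  exact_mod_cast this.le.trans (min_le_left _ _)

/-- A discretization from above of the stopping time `min t τ`. -/
lemma isStoppingTime_roundUp {τ : Ω → WithTop ℝ≥0} (hτ : IsStoppingTime 𝓕 τ) (t : ℝ≥0) (j : ℕ) :
    IsStoppingTime 𝓕
      fun ω => ((min t (roundUp j (min (t : WithTop ℝ≥0) (τ ω)).untopA) : ℝ≥0) : WithTop ℝ≥0) := by
  intro i
  by_cases hti : t ≤ i
  · convert MeasurableSet.univ
    ext ω
    simp only [mem_ofPred_eq, mem_univ, iff_true, WithTop.coe_le_coe]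
    exact (min_le_left _ _).trans hti
  -- `c` is the largest grid point not exceeding `i`. Since rounding goes strictly upward, the event
  -- is `min t τ < c`, which is known at time `c`.
  · set c : ℝ≥0 := (⌊((j : ℝ≥0) + 1) * i⌋₊ : ℝ≥0) / ((j : ℝ≥0) + 1) with hc
    have hci : c ≤ i := by
      rw [hc, div_le_iff₀ (by positivity), mul_comm i]
      exact Nat.floor_le (by positivity)
    convert 𝓕.mono hci _ (((isStoppingTime_const 𝓕 t).min hτ).measurableSet_lt c) using 1
    ext ω
    simp only [mem_ofPred_eq, WithTop.coe_le_coe, min_le_iff, hti, false_or, roundUp_le_iff, ← hc]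
    nth_rewrite 2 [← coe_untopA_min t (τ ω)]
    rw [WithTop.coe_lt_coe]

lemma martingale_of_setIntegral_eq [IsFiniteMeasure μ] {Z : ℝ≥0 → Ω → ℝ}
    (hZ : StronglyAdapted 𝓕 Z) (hint : ∀ t, Integrable (Z t) μ)
    (h : ∀ s t, s ≤ t → ∀ A, MeasurableSet[𝓕 s] A → ∫ ω in A, Z t ω ∂μ = ∫ ω in A, Z s ω ∂μ) :
    Martingale Z 𝓕 μ := by
  refine ⟨hZ, fun s t hst => ?_⟩
  refine (ae_eq_condExp_of_forall_setIntegral_eq (𝓕.le s) (hint t)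
    (fun A _ _ => (hint s).integrableOn) (fun A hA _ => (h s t hst A hA).symm)
    (hZ s).aestronglyMeasurable).symm

/-- Optional sampling for right-continuous martingales at the bounded stopping time `min t τ`. -/
lemma setIntegral_stoppedProcess_of_martingale [IsFiniteMeasure μ] {M : ℝ≥0 → Ω → ℝ}
    (hM : Martingale M 𝓕 μ) (hc : ∀ ω t, ContinuousWithinAt (fun s => M s ω) (Ici t) t)
    {τ : Ω → WithTop ℝ≥0} (hτ : IsStoppingTime 𝓕 τ) (t : ℝ≥0) :
    Integrable (stoppedProcess M τ t) μ ∧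
      ∀ A, MeasurableSet[((isStoppingTime_const 𝓕 t).min hτ).measurableSpace] A →
        ∫ ω in A, stoppedProcess M τ t ω ∂μ = ∫ ω in A, M t ω ∂μ := by
  set σ : ℕ → Ω → WithTop ℝ≥0 := fun j ω =>
    ((min t (roundUp j (min (t : WithTop ℝ≥0) (τ ω)).untopA) : ℝ≥0) : WithTop ℝ≥0) with hσdef
  have hσ : ∀ j, IsStoppingTime 𝓕 (σ j) := fun j => isStoppingTime_roundUp hτ t j
  have hσle : ∀ j ω, σ j ω ≤ t := fun j ω => WithTop.coe_le_coe.2 (min_le_left _ _)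
  have hσge : ∀ j ω, min (t : WithTop ℝ≥0) (τ ω) ≤ σ j ω := by
    intro j ω
    rw [← coe_untopA_min t (τ ω)]
    exact WithTop.coe_le_coe.2 (le_min (untopA_min_le _ _) (lt_roundUp _ _).le)
  have hcount : ∀ j, (range (σ j)).Countable := by
    intro j
    refine ((countable_range_roundUp j).image
      fun x => ((min t x : ℝ≥0) : WithTop ℝ≥0)).mono ?_
    rintro _ ⟨ω, rfl⟩
    exact ⟨_, ⟨_, rfl⟩, rfl⟩
  have hae : ∀ j, μ[M t | (hσ j).measurableSpace] =ᵐ[μ] stoppedValue M (σ j) := fun j =>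
    (hM.stoppedValue_ae_eq_condExp_of_le_const_of_countable_range (hσ j) (hσle j)
      (hcount j)).symm
  -- All sampled values are conditional expectations of the single variable `M t`; the resulting
  -- uniform integrability upgrades pointwise convergence to convergence in L¹.
  have hUI : UniformIntegrable (fun j => stoppedValue M (σ j)) 1 μ :=
    ((hM.integrable t).uniformIntegrable_condExp fun j => (hσ j).measurableSpace_le).ae_eq hae
  have hlim : ∀ ω, Tendsto (fun j => stoppedValue M (σ j) ω) atTop
      (𝓝 (stoppedProcess M τ t ω)) := by
    intro ω
    refine (hc ω _).tendsto.comp (tendsto_nhdsWithin_iff.2 ⟨?_, Eventually.of_forall fun j => ?_⟩)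
    · have := (tendsto_const_nhds (x := t)).min
        (tendsto_roundUp (min (t : WithTop ℝ≥0) (τ ω)).untopA)
      rw [min_eq_right (untopA_min_le _ _)] at this
      exact this
    · exact le_min (untopA_min_le _ _) (lt_roundUp _ _).le
  have hint : Integrable (stoppedProcess M τ t) μ :=
    hUI.integrable_of_ae_tendsto (Eventually.of_forall hlim)
  refine ⟨hint, fun A hA => ?_⟩
  have hL1 := tendsto_Lp_finite_of_tendsto_ae le_rfl ENNReal.one_ne_top (fun j => hUI.1 j)
    (memLp_one_iff_integrable.2 hint) hUI.2.1 (Eventually.of_forall hlim)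
  have hI : ∀ j, Integrable (stoppedValue M (σ j)) μ := fun j =>
    (integrable_congr (hae j)).1 integrable_condExp
  have h1 := tendsto_setIntegral_of_L1' _ hint.1 (Eventually.of_forall hI) hL1 A
  have h2 : ∀ j, ∫ ω in A, stoppedValue M (σ j) ω ∂μ = ∫ ω in A, M t ω ∂μ := by
    intro j
    have hA' : MeasurableSet[(hσ j).measurableSpace] A :=
      ((isStoppingTime_const 𝓕 t).min hτ).measurableSpace_mono (hσ j) (hσge j) _ hA
    rw [← setIntegral_condExp (hσ j).measurableSpace_le (hM.integrable t) hA']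
    exact (setIntegral_congr_ae ((hσ j).measurableSpace_le _ hA')
      ((hae j).mono fun ω h _ => h)).symm
  simp_rw [h2] at h1
  exact tendsto_nhds_unique tendsto_const_nhds h1 |>.symm

lemma stoppedProcess_eq_of_le_of_le {β : Type*} {u : ℝ≥0 → Ω → β} {τ : Ω → WithTop ℝ≥0} {ω : Ω}
    {s t : ℝ≥0} (hs : τ ω ≤ s) (hst : s ≤ t) :
    stoppedProcess u τ t ω = stoppedProcess u τ s ω := by
  rw [stoppedProcess_eq_of_ge hs,
    stoppedProcess_eq_of_ge (hs.trans (WithTop.coe_le_coe.2 hst))]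

/-- If the set integrals of a stopped process do not change before the stopping time, then they
do not change at all. -/
lemma setIntegral_stoppedProcess_eq {u : ℝ≥0 → Ω → ℝ} {τ : Ω → WithTop ℝ≥0}
    (hτ : IsStoppingTime 𝓕 τ) (hint : ∀ t, Integrable (stoppedProcess u τ t) μ) {s t : ℝ≥0}
    (hst : s ≤ t) {A : Set Ω} (hA : MeasurableSet[𝓕 s] A)
    (h : ∫ ω in A ∩ {ω | s ≤ τ ω}, stoppedProcess u τ t ω ∂μ =
      ∫ ω in A ∩ {ω | s ≤ τ ω}, stoppedProcess u τ s ω ∂μ) :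
    ∫ ω in A, stoppedProcess u τ t ω ∂μ = ∫ ω in A, stoppedProcess u τ s ω ∂μ := by
  have hm : MeasurableSet {ω | s ≤ τ ω} := 𝓕.le s _ (hτ.measurableSet_ge s)
  rw [← integral_inter_add_sdiff hm (hint t).integrableOn,
    ← integral_inter_add_sdiff hm (hint s).integrableOn, h]
  congr 1
  -- Off `{s ≤ τ}` the process has already stopped before time `s`.
  refine setIntegral_congr_fun ((𝓕.le s _ hA).diff hm) fun ω hω => ?_
  exact stoppedProcess_eq_of_le_of_le (not_le.1 hω.2).le hst

/-- On `{s ≤ τ}`, what is known at time `s` is known at `min s τ`, hence at `min t τ`. This supplies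
the events on which optional sampling and the density relation are applied. -/
lemma measurableSet_inter_const_le {τ : Ω → WithTop ℝ≥0} (hτ : IsStoppingTime 𝓕 τ) {s t : ℝ≥0}
    (hst : s ≤ t) {A : Set Ω} (hA : MeasurableSet[𝓕 s] A) :
    MeasurableSet[((isStoppingTime_const 𝓕 t).min hτ).measurableSpace]
      (A ∩ {ω | s ≤ τ ω}) := by
  have h1 : MeasurableSet[((isStoppingTime_const 𝓕 s).min hτ).measurableSpace]
      (A ∩ {ω | s ≤ τ ω}) := by
    refine (isStoppingTime_const 𝓕 s).measurableSet_inter_le hτ A ?_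
    rwa [IsStoppingTime.measurableSpace_const]
  refine IsStoppingTime.measurableSpace_mono _ _ (fun ω => ?_) _ h1
  exact min_le_min_right _ (WithTop.coe_le_coe.2 hst)

lemma martingale_stoppedProcess [IsFiniteMeasure μ] {M : ℝ≥0 → Ω → ℝ}
    (hM : Martingale M 𝓕 μ) (hc : ∀ ω t, ContinuousWithinAt (fun s => M s ω) (Ici t) t)
    {τ : Ω → WithTop ℝ≥0} (hτ : IsStoppingTime 𝓕 τ) :
    Martingale (stoppedProcess M τ) 𝓕 μ := by
  have hint := fun t => (setIntegral_stoppedProcess_of_martingale hM hc hτ t).1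
  have hprog := isStronglyProgressive_of_rightContinuous hM.1 hc
  refine martingale_of_setIntegral_eq (hprog.stronglyAdapted_stoppedProcess hτ) hint
    fun s t hst A hA => setIntegral_stoppedProcess_eq hτ hint hst hA ?_
  rw [(setIntegral_stoppedProcess_of_martingale hM hc hτ t).2 _
      (measurableSet_inter_const_le hτ hst hA),
    (setIntegral_stoppedProcess_of_martingale hM hc hτ s).2 _
      (measurableSet_inter_const_le hτ le_rfl hA)]
  exact (hM.setIntegral_eq hst (hA.inter (hτ.measurableSet_ge s))).symm

/-- A pointwise bounded limit of martingales is a martingale. -/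
lemma martingale_of_tendsto_of_bounded [IsFiniteMeasure μ] {Z : ℝ≥0 → Ω → ℝ}
    {Zn : ℕ → ℝ≥0 → Ω → ℝ} (hZ : StronglyAdapted 𝓕 Z) (hn : ∀ n, Martingale (Zn n) 𝓕 μ) (C : ℝ)
    (hb : ∀ n t, ∀ᵐ ω ∂μ, ‖Zn n t ω‖ ≤ C)
    (hlim : ∀ t, ∀ᵐ ω ∂μ, Tendsto (fun n => Zn n t ω) atTop (𝓝 (Z t ω))) :
    Martingale Z 𝓕 μ := by
  have hlimA : ∀ t (A : Set Ω), Tendsto (fun n => ∫ ω in A, Zn n t ω ∂μ) atTop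
      (𝓝 (∫ ω in A, Z t ω ∂μ)) := fun t A =>
    tendsto_integral_of_dominated_convergence (fun _ => C)
      (fun n => ((hn n).integrable t).1.restrict) (integrable_const C)
      (fun n => ae_restrict_of_ae (hb n t)) (ae_restrict_of_ae (hlim t))
  refine martingale_of_setIntegral_eq hZ (fun t => ?_) fun s t hst A hA => ?_
  · refine Integrable.of_bound ((hZ t).mono (𝓕.le t)).aestronglyMeasurable C ?_
    filter_upwards [hlim t, ae_all_iff.2 fun n => hb n t] with ω h1 h2
    exact le_of_tendsto h1.norm (Eventually.of_forall h2)
  · refine tendsto_nhds_unique (hlimA t A) ((hlimA s A).congr fun n => ?_)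
    exact (hn n).setIntegral_eq hst hA

lemma uniformIntegrable_of_bounded [IsFiniteMeasure μ] {ι : Type*} {f : ι → Ω → ℝ} (C : ℝ≥0)
    (hf : ∀ i, AEStronglyMeasurable (f i) μ) (hb : ∀ i, ∀ᵐ ω ∂μ, ‖f i ω‖ ≤ C) :
    UniformIntegrable f 1 μ := by
  refine uniformIntegrable_of le_rfl ENNReal.one_ne_top hf fun ε hε => ⟨C + 1, fun i => ?_⟩
  have : ({x | C + 1 ≤ ‖f i x‖₊}.indicator (f i)) =ᵐ[μ] 0 := by
    filter_upwards [hb i] with ω hω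
    refine indicator_of_notMem (fun h => ?_) _
    have h1 : (C : ℝ) + 1 ≤ ‖f i ω‖ := by exact_mod_cast (show C + 1 ≤ ‖f i ω‖₊ from h)
    linarith
  rw [eLpNorm_congr_ae this]
  simp

end General

/-! ### Absorbed paths -/

section Paths

variable {ω : ℝ≥0 → ℝ≥0∞}

lemma hittingTime_le_of_valueAt_eq {a : ℝ≥0∞} {t : WithTop ℝ≥0} (h : valueAt ω t = a) :
    hittingTime a ω ≤ (t : WithTop (WithTop ℝ≥0)) :=
  sInf_le ⟨t, h, rfl⟩

lemma IsAbsorbedPath.coe_lt_hittingTime_top_iff (hω : IsAbsorbedPath ω) (t : ℝ≥0) :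
    ((t : WithTop ℝ≥0) : WithTop (WithTop ℝ≥0)) < hittingTime ∞ ω ↔ ω t ≠ ∞ := by
  constructor
  · intro h ht
    exact absurd (hittingTime_le_of_valueAt_eq (ω := ω) (t := (t : WithTop ℝ≥0)) ht) (not_le.2 h)
  · intro ht
    by_contra hlt
    rcases (not_lt.1 hlt).eq_or_lt with h | h
    · exact ht (hω.hitting_attained t h)
    · obtain ⟨_, ⟨u, hu, rfl⟩, hut⟩ := sInf_lt_iff.1 h
      have hut' : u < t := WithTop.coe_lt_coe.1 hut
      lift u to ℝ≥0 using ne_top_of_lt hut'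
      exact ht (hω.absorbed_top u t (WithTop.coe_lt_coe.1 hut').le hu)

lemma hittingTime_top_eq_top_iff :
    hittingTime ∞ ω = ⊤ ↔ (∀ t, ω t ≠ ∞) ∧ terminalValue ω ≠ ∞ := by
  constructor
  · intro h
    have key : ∀ t : WithTop ℝ≥0, valueAt ω t ≠ ∞ := by
      intro t ht
      have := hittingTime_le_of_valueAt_eq ht
      rw [h] at this
      exact WithTop.coe_ne_top (top_le_iff.1 this)
    exact ⟨fun t => key t, key ⊤⟩
  · rintro ⟨h1, h2⟩
    refine sInf_eq_top.2 ?_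
    rintro _ ⟨t, ht, rfl⟩
    cases t with
    | top => exact absurd ht h2
    | coe t => exact absurd ht (h1 t)

/-- A path is either finite at all times, or is infinite exactly from some time on. -/
lemma IsAbsorbedPath.forall_ne_top_or_exists (hω : IsAbsorbedPath ω) :
    (∀ t, ω t ≠ ∞) ∨ ∃ S, ∀ t, ω t = ∞ ↔ S ≤ t := by
  by_cases h : ∀ t, ω t ≠ ∞
  · exact Or.inl h
  · push Not at h
    obtain ⟨t, ht⟩ := h
    have hle := hittingTime_le_of_valueAt_eq (ω := ω) (t := (t : WithTop ℝ≥0)) ht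
    obtain ⟨s', hs'⟩ := WithTop.ne_top_iff_exists.1 (ne_top_of_le_ne_top WithTop.coe_ne_top hle)
    rw [← hs'] at hle
    obtain ⟨S, rfl⟩ := WithTop.ne_top_iff_exists.1
      (ne_top_of_le_ne_top WithTop.coe_ne_top (WithTop.coe_le_coe.1 hle))
    refine Or.inr ⟨S, fun u => ?_⟩
    have h1 := (hω.coe_lt_hittingTime_top_iff u).not
    rw [← hs', not_lt, WithTop.coe_le_coe, WithTop.coe_le_coe, not_not] at h1
    exact h1.symm

lemma IsAbsorbedPath.isOpen_ne_top (hω : IsAbsorbedPath ω) : IsOpen {t | ω t ≠ ∞} := by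
  rcases hω.forall_ne_top_or_exists with h | ⟨S, hS⟩
  · convert isOpen_univ
    simpa [eq_univ_iff_forall] using h
  · convert isOpen_Iio (a := S)
    ext t
    simp [hS]

lemma IsAbsorbedPath.continuousAt (hω : IsAbsorbedPath ω) {t : ℝ≥0} (ht : ω t ≠ ∞) :
    ContinuousAt ω t := by
  have h := hω.continuousOn
  simp_rw [hω.coe_lt_hittingTime_top_iff] at h
  exact h.continuousAt (hω.isOpen_ne_top.mem_nhds ht)

lemma IsAbsorbedPath.ne_top_of_le (hω : IsAbsorbedPath ω) {s t : ℝ≥0} (hst : s ≤ t)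
    (ht : ω t ≠ ∞) : ω s ≠ ∞ :=
  fun hs => ht (hω.absorbed_top s t hst hs)

/-- No continuity of `f` at `∞` is needed, as for `ENNReal.toReal`: absorption makes the path
constant once it is infinite. -/
lemma IsAbsorbedPath.continuousWithinAt_comp {β : Type*} [TopologicalSpace β] (hω : IsAbsorbedPath ω)
    {f : ℝ≥0∞ → β} (hf : ∀ x ≠ ∞, ContinuousAt f x) (t : ℝ≥0) :
    ContinuousWithinAt (fun s => f (ω s)) (Ici t) t := by
  by_cases ht : ω t = ∞
  · refine (continuousWithinAt_const (b := f ∞)).congr (fun s hs => ?_) (by rw [ht])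
    rw [hω.absorbed_top t s hs ht]
  · exact (ContinuousAt.comp (f := ω) (hf _ ht) (hω.continuousAt ht)).continuousWithinAt

lemma IsAbsorbedPath.continuousWithinAt (hω : IsAbsorbedPath ω) (t : ℝ≥0) :
    ContinuousWithinAt ω (Ici t) t :=
  hω.continuousWithinAt_comp (f := id) (fun _ _ => continuousAt_id) t

lemma IsAbsorbedPath.continuousOn_Icc (hω : IsAbsorbedPath ω) {t : ℝ≥0} (ht : ω t ≠ ∞) :
    ContinuousOn ω (Icc 0 t) := fun _ hs =>
  (hω.continuousAt (hω.ne_top_of_le hs.2 ht)).continuousWithinAt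

/-- A path which is finite at time `t` is bounded on `[0, t]`. -/
lemma IsAbsorbedPath.exists_bound (hω : IsAbsorbedPath ω) {t : ℝ≥0} (ht : ω t ≠ ∞) :
    ∃ C, C ≠ ∞ ∧ ∀ s ≤ t, ω s ≤ C := by
  obtain ⟨u, hu, hmax⟩ := isCompact_Icc.exists_isMaxOn (nonempty_Icc.2 zero_le)
    (hω.continuousOn_Icc ht)
  exact ⟨ω u, hω.ne_top_of_le hu.2 ht, fun s hs => hmax ⟨zero_le, hs⟩⟩

end Paths

/-! ### Adaptedness and hitting times of the coordinate process -/

lemma stronglyAdapted_X : StronglyAdapted canonicalFiltration X :=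
  Filtration.stronglyAdapted_natural _

lemma measurable_X {s t : ℝ≥0} (hst : s ≤ t) : Measurable[canonicalFiltration t] (X s) :=
  ((stronglyAdapted_X s).mono (canonicalFiltration.mono hst)).measurable

lemma isStronglyProgressive_X : IsStronglyProgressive canonicalFiltration X :=
  isStronglyProgressive_of_rightContinuous stronglyAdapted_X fun ω t => ω.2.continuousWithinAt t

/-- A path finite at `t` is continuous on `[0, t]`, so the infimum of `g ∘ X` there is attained and
is computed along countably many times. Both the identity and inversion are used for `g`. -/
lemma measurableSet_exists_le {g : ℝ≥0∞ → ℝ≥0∞} (hg : Continuous g) (a : ℝ≥0∞) (t : ℝ≥0) :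
    MeasurableSet[canonicalFiltration t] {ω | X t ω ≠ ∞ ∧ ∃ u ≤ t, g (X u ω) ≤ a} := by
  let d := TopologicalSpace.denseSeq ℝ≥0
  have hd : DenseRange d := TopologicalSpace.denseRange_denseSeq ℝ≥0
  have key : {ω | X t ω ≠ ∞ ∧ ∃ u ≤ t, g (X u ω) ≤ a} =
      {ω | X t ω = ∞}ᶜ ∩ {ω | ⨅ k, g (X (min (d k) t) ω) ≤ a} := by
    ext ω
    simp only [mem_ofPred_eq, mem_inter_iff, mem_compl_iff, and_congr_right_iff]
    intro ht
    have hc : ContinuousOn (fun s => g (X s ω)) (Icc 0 t) :=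
      hg.comp_continuousOn (ω.2.continuousOn_Icc ht)
    constructor
    · rintro ⟨u, hu, hua⟩
      refine le_trans ?_ hua
      have hc' : Continuous fun s => g (X (min s t) ω) := by
        rw [← continuousOn_univ]
        exact hc.comp (by fun_prop) fun s _ => ⟨zero_le, min_le_right _ _⟩
      have := hd.induction_on (p := fun s => ⨅ k, g (X (min (d k) t) ω) ≤ g (X (min s t) ω)) u
        (isClosed_le continuous_const hc') fun k => iInf_le _ k
      rwa [min_eq_left hu] at this
    · intro h
      obtain ⟨u, hu, hmin⟩ := isCompact_Icc.exists_isMinOn (nonempty_Icc.2 zero_le) hc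
      exact ⟨u, hu.2, (le_iInf fun k => hmin ⟨zero_le, min_le_right _ _⟩).trans h⟩
  rw [key]
  refine MeasurableSet.inter (measurable_X le_rfl (measurableSet_singleton _)).compl ?_
  refine measurableSet_le (Measurable.iInf fun k => ?_) measurable_const
  exact hg.measurable.comp (measurable_X (min_le_right _ _))

/-- The infimum is approached from the right by visits to `C`, so right-continuity suffices even at
a jump to `∞`. -/
lemma X_mem_of_hittingAfter_eq {C : Set ℝ≥0∞} (hC : IsClosed C) {ω : PathSpace} {s : ℝ≥0}
    (h : hittingAfter X C 0 ω = s) : X s ω ∈ C := by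
  have hne : hittingAfter X C 0 ω ≠ ⊤ := by rw [h]; exact WithTop.coe_ne_top
  have hex : ∃ j, (0 : ℝ≥0) ≤ j ∧ X j ω ∈ C := by
    rw [ne_eq, hittingAfter_eq_top_iff] at hne
    push Not at hne
    exact hne
  rw [hittingAfter, if_pos hex] at h
  have hs : sInf {i | 0 ≤ i ∧ X i ω ∈ C} = s := WithTop.coe_injective h
  have hcl := csInf_mem_closure (s := {i | 0 ≤ i ∧ X i ω ∈ C}) hex (OrderBot.bddBelow _)
  rw [hs] at hcl
  rw [← hC.closure_eq]
  refine ((ω.2.continuousWithinAt s).mono fun i hi => ?_).mem_closure hcl fun i hi => hi.2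
  rw [mem_Ici, ← hs]
  exact csInf_le (OrderBot.bddBelow _) hi

lemma hittingAfter_X_le_iff {C : Set ℝ≥0∞} (hC : IsClosed C) {ω : PathSpace} {t : ℝ≥0} :
    hittingAfter X C 0 ω ≤ t ↔ ∃ u ≤ t, X u ω ∈ C := by
  constructor
  · intro h
    obtain ⟨s, hs⟩ := WithTop.ne_top_iff_exists.1 (ne_top_of_le_ne_top WithTop.coe_ne_top h)
    rw [← hs] at h
    exact ⟨s, WithTop.coe_le_coe.1 h, X_mem_of_hittingAfter_eq hC hs.symm⟩
  · rintro ⟨u, hu, hmem⟩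
    exact (hittingAfter_le_of_mem zero_le hmem).trans (WithTop.coe_le_coe.2 hu)

/-- The first time at which the coordinate process is at least `a`. -/
def upTime (a : ℝ≥0∞) : PathSpace → WithTop ℝ≥0 := hittingAfter X (Ici a) 0

/-- The first time at which the coordinate process is at most `a`. -/
def downTime (a : ℝ≥0∞) : PathSpace → WithTop ℝ≥0 := hittingAfter X (Iic a) 0

lemma isStoppingTime_upTime (a : ℝ≥0∞) : IsStoppingTime canonicalFiltration (upTime a) := by
  intro t
  have key : {ω | upTime a ω ≤ t} =
      {ω | X t ω = ∞} ∪ {ω | X t ω ≠ ∞ ∧ ∃ u ≤ t, (X u ω)⁻¹ ≤ a⁻¹} := by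
    ext ω
    simp only [upTime, mem_ofPred_eq, hittingAfter_X_le_iff isClosed_Ici, mem_union, mem_Ici,
      ENNReal.inv_le_inv]
    by_cases ht : X t ω = ∞
    · simp only [ht, true_or, iff_true]
      exact ⟨t, le_rfl, by simp [ht]⟩
    · simp [ht]
  rw [key]
  exact (measurable_X le_rfl (measurableSet_singleton _)).union
    (measurableSet_exists_le continuous_inv _ t)

/-- A path that is infinite at `t` need not be continuous on `[0, t]`. Its visit to a finite level
precedes the explosion, and some time of a dense sequence in between detects it. -/
lemma isStoppingTime_downTime {a : ℝ≥0∞} (ha : a ≠ ∞) :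
    IsStoppingTime canonicalFiltration (downTime a) := by
  intro t
  let d := TopologicalSpace.denseSeq ℝ≥0
  have hd : DenseRange d := TopologicalSpace.denseRange_denseSeq ℝ≥0
  have key : {ω | downTime a ω ≤ t} =
      {ω | X t ω ≠ ∞ ∧ ∃ u ≤ t, X u ω ≤ a} ∪
        ⋃ k, {ω | X (min (d k) t) ω ≠ ∞ ∧ ∃ u ≤ min (d k) t, X u ω ≤ a} := by
    ext ω
    simp only [downTime, mem_ofPred_eq, hittingAfter_X_le_iff isClosed_Iic, mem_union, mem_Iic,
      mem_iUnion]
    constructor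
    · rintro ⟨u, hu, hua⟩
      by_cases ht : X t ω = ∞
      · rcases ω.2.forall_ne_top_or_exists with h | ⟨S, hS⟩
        · exact absurd ht (h t)
        · have huS : u < S := by
            by_contra hcon
            exact ne_top_of_le_ne_top ha hua ((hS u).2 (not_lt.1 hcon))
          have hSt : S ≤ t := (hS t).1 ht
          obtain ⟨k, hk⟩ := hd.exists_mem_open (isOpen_Ioo (a := u) (b := S)) (nonempty_Ioo.2 huS)
          refine Or.inr ⟨k, ?_, u, le_min hk.1.le hu, hua⟩
          rw [min_eq_left (hk.2.le.trans hSt)]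
          exact fun h => absurd ((hS _).1 h) (not_le.2 hk.2)
      · exact Or.inl ⟨ht, u, hu, hua⟩
    · rintro (⟨_, h⟩ | ⟨k, _, u, hu, hua⟩)
      · exact h
      · exact ⟨u, hu.trans (min_le_right _ _), hua⟩
  rw [key]
  refine (measurableSet_exists_le continuous_id a t).union (MeasurableSet.iUnion fun k => ?_)
  exact canonicalFiltration.mono (min_le_right (d k) t) _
    (measurableSet_exists_le continuous_id a _)

variable {ω : PathSpace} {a : ℝ≥0∞} {s t : ℝ≥0}

lemma le_X_of_upTime_eq (h : upTime a ω = s) : a ≤ X s ω :=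
  X_mem_of_hittingAfter_eq isClosed_Ici h

lemma X_le_of_downTime_eq (h : downTime a ω = s) : X s ω ≤ a :=
  X_mem_of_hittingAfter_eq isClosed_Iic h

lemma X_lt_of_lt_upTime (h : s < upTime a ω) : X s ω < a :=
  not_le.1 (notMem_of_lt_hittingAfter h zero_le)

lemma lt_X_of_lt_downTime (h : s < downTime a ω) : a < X s ω :=
  not_le.1 (notMem_of_lt_hittingAfter h zero_le)

lemma upTime_le_of_le (h : a ≤ X t ω) : upTime a ω ≤ t :=
  hittingAfter_le_of_mem zero_le h

lemma upTime_eq_top_iff : upTime a ω = ⊤ ↔ ∀ t, X t ω < a := by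
  simp [upTime, hittingAfter_eq_top_iff]

lemma downTime_eq_top_iff : downTime a ω = ⊤ ↔ ∀ t, a < X t ω := by
  simp [downTime, hittingAfter_eq_top_iff]

lemma upTime_mono (ω : PathSpace) : Monotone fun a => upTime a ω := fun _ _ h =>
  hittingAfter_apply_anti X 0 ω (Ici_subset_Ici.2 h)

lemma downTime_anti (ω : PathSpace) : Antitone fun a => downTime a ω := fun _ _ h =>
  hittingAfter_apply_anti X 0 ω (Iic_subset_Iic.2 h)

/-- At a time with finite value the path is also left-continuous, so a closed condition passes to
the limit. -/
lemma X_mem_of_forall_lt {C : Set ℝ≥0∞} (hC : IsClosed C) (h0 : X 0 ω ∈ C) (ht : X t ω ≠ ∞)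
    (h : ∀ u < t, X u ω ∈ C) : X t ω ∈ C := by
  rcases eq_or_ne t 0 with rfl | hpos
  · exact h0
  · have hc : ContinuousWithinAt ω.1 (Iio t) t := (ω.2.continuousAt ht).continuousWithinAt
    have hcl : t ∈ closure (Iio t) := by
      rw [closure_Iio' (a := t) ⟨0, pos_iff_ne_zero.2 hpos⟩]
      exact self_mem_Iic
    rw [← hC.closure_eq]
    exact hc.mem_closure hcl h

lemma eventually_lt_upTime (ht : X t ω ≠ ∞) : ∀ᶠ n : ℕ in atTop, (t : WithTop ℝ≥0) < upTime n ω := by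
  obtain ⟨C, hC, hb⟩ := ω.2.exists_bound ht
  obtain ⟨N, hN⟩ := ENNReal.exists_nat_gt hC
  filter_upwards [eventually_ge_atTop N] with n hn
  by_contra hcon
  obtain ⟨u, hu, hmem⟩ := (hittingAfter_X_le_iff isClosed_Ici).1 (not_lt.1 hcon)
  have : (N : ℝ≥0∞) ≤ n := by exact_mod_cast hn
  exact absurd (hmem.trans (hb u hu)) (not_le.2 (hN.trans_le this))

/-- The coordinate process stopped at the minimum of `t` and a down-crossing time is positive. -/
lemma le_X_min_downTime (h0 : 0 < downTime a ω) (t : ℝ≥0) {κ : WithTop ℝ≥0}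
    (hκ : κ ≤ downTime a ω) :
    a ≤ X (min (t : WithTop ℝ≥0) κ).untopA ω := by
  set r := (min (t : WithTop ℝ≥0) κ).untopA with hr
  have hrle : (r : WithTop ℝ≥0) ≤ downTime a ω := by
    rw [hr, coe_untopA_min]
    exact (min_le_right _ _).trans hκ
  by_cases hX : X r ω = ∞
  · rw [hX]
    exact le_top
  refine X_mem_of_forall_lt isClosed_Ici (lt_X_of_lt_downTime h0).le hX fun u hu => ?_
  exact (lt_X_of_lt_downTime ((WithTop.coe_lt_coe.2 hu).trans_le hrle)).le

/-- The coordinate process stopped at the minimum of `t` and an up-crossing time is bounded, unless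
it jumps to infinity. -/
lemma X_min_upTime_le (h0 : X 0 ω ≤ a) (t : ℝ≥0) {κ : WithTop ℝ≥0} (hκ : κ ≤ upTime a ω)
    (hX : X (min (t : WithTop ℝ≥0) κ).untopA ω ≠ ∞) :
    X (min (t : WithTop ℝ≥0) κ).untopA ω ≤ a := by
  set r := (min (t : WithTop ℝ≥0) κ).untopA with hr
  have hrle : (r : WithTop ℝ≥0) ≤ upTime a ω := by
    rw [hr, coe_untopA_min]
    exact (min_le_right _ _).trans hκ
  refine X_mem_of_forall_lt isClosed_Iic h0 hX fun u hu => ?_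
  exact (X_lt_of_lt_upTime ((WithTop.coe_lt_coe.2 hu).trans_le hrle)).le

lemma continuousWithinAt_stoppedProcess {Ω β : Type*} [TopologicalSpace β] {u : ℝ≥0 → Ω → β}
    {ω : Ω} (hc : ∀ t, ContinuousWithinAt (fun s => u s ω) (Ici t) t) (τ : Ω → WithTop ℝ≥0)
    (t : ℝ≥0) : ContinuousWithinAt (fun s => stoppedProcess u τ s ω) (Ici t) t := by
  by_cases h : τ ω = ⊤
  · have heq : ∀ s : ℝ≥0, stoppedProcess u τ s ω = u s ω := fun s =>
      stoppedProcess_eq_of_le (by rw [h]; exact le_top)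
    simp_rw [heq]
    exact hc t
  · obtain ⟨c, hτ⟩ := WithTop.ne_top_iff_exists.1 h
    have heq : ∀ s : ℝ≥0, stoppedProcess u τ s ω = u (min s c) ω := by
      intro s
      rw [stoppedProcess, ← hτ, ← WithTop.coe_min]
      rfl
    simp_rw [heq]
    refine ContinuousWithinAt.comp (f := fun s => min s c) (g := fun s => u s ω) (t := Ici (min t c))
      (hc _) (by fun_prop) fun s hs => ?_
    exact min_le_min_right _ (mem_Ici.1 hs)

lemma stronglyAdapted_stoppedProcess_comp {τ : PathSpace → WithTop ℝ≥0}
    (hτ : IsStoppingTime canonicalFiltration τ) {f : ℝ≥0∞ → ℝ} (hf : Measurable f) :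
    StronglyAdapted canonicalFiltration (fun t ω => f (stoppedProcess X τ t ω)) := fun t =>
  (hf.comp (isStronglyProgressive_X.stronglyAdapted_stoppedProcess hτ t).measurable).stronglyMeasurable

/-! ### Stopping times at which the density relation holds -/

section Original

variable {P : Measure PathSpace} [IsProbabilityMeasure P]

lemma ae_X_zero_eq_one (hX0 : P {ω | X 0 ω = 1} = 1) : ∀ᵐ ω ∂P, X 0 ω = 1 := by
  have hm : MeasurableSet {ω | X 0 ω = 1} :=
    canonicalFiltration.le 0 _ (measurable_X le_rfl (measurableSet_singleton 1))
  exact (mem_ae_iff_prob_eq_one hm).2 hX0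

/-- The coordinate process stopped before its passage over a finite level is a uniformly integrable
martingale. -/
theorem isUIMartingaleStopped_of_le_upTime
    (hX : IsNonnegLocalMartingale X canonicalFiltration P) (hX0 : P {ω | X 0 ω = 1} = 1)
    {n : ℕ} (hn : 1 ≤ n) {κ : PathSpace → WithTop ℝ≥0}
    (hκ : IsStoppingTime canonicalFiltration κ) (hle : ∀ ω, κ ω ≤ upTime n ω) :
    IsUIMartingaleStopped P κ := by
  obtain ⟨σ, hσ, hM⟩ := hX.locally_martingale
  have hbound : ∀ᵐ ω ∂P, ∀ (t : ℝ≥0) (κ' : WithTop ℝ≥0), κ' ≤ κ ω →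
      ‖(X (min (t : WithTop ℝ≥0) κ').untopA ω).toReal‖ ≤ n := by
    filter_upwards [hX.finite, ae_X_zero_eq_one hX0] with ω hfin h0 t κ' hκ'
    rw [Real.norm_of_nonneg ENNReal.toReal_nonneg]
    refine ENNReal.toReal_le_of_le_ofReal (Nat.cast_nonneg _) ?_
    rw [ENNReal.ofReal_natCast]
    refine X_min_upTime_le ?_ t (hκ'.trans (hle ω)) (hfin _)
    rw [h0]
    exact_mod_cast hn
  have hZ : StronglyAdapted canonicalFiltration (stoppedProcess (fun t ω => (X t ω).toReal) κ) :=
    stronglyAdapted_stoppedProcess_comp hκ ENNReal.measurable_toReal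
  -- The indicator is the one built into `Locally`; it equals one as soon as `σ k` is positive.
  set M : ℕ → ℝ≥0 → PathSpace → ℝ := fun k => stoppedProcess
    (fun i => {ω | ⊥ < σ k ω}.indicator ((fun t ω => (X t ω).toReal) i)) (σ k) with hMdef
  have hMrc : ∀ k ω t, ContinuousWithinAt (fun s => M k s ω) (Ici t) t := by
    intro k ω t
    refine continuousWithinAt_stoppedProcess (fun t => ?_) _ t
    by_cases h : ω ∈ {ω | ⊥ < σ k ω}
    · simp only [indicator_of_mem h]
      exact ω.2.continuousWithinAt_comp (fun x hx => ENNReal.continuousAt_toReal hx) t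
    · simp only [indicator_of_notMem h]
      exact continuousWithinAt_const
  have hMκ : ∀ k t ω, stoppedProcess (M k) κ t ω = {ω | ⊥ < σ k ω}.indicator
      (fun ω => (X (min (t : WithTop ℝ≥0) (min (κ ω) (σ k ω))).untopA ω).toReal) ω := by
    intro k t ω
    rw [hMdef]
    simp only [stoppedProcess_stoppedProcess]
    simp only [stoppedProcess, indicator]
    rfl
  -- Stopped again at `κ`, the localized martingales are almost surely bounded by `n`, and at each
  -- time `t` they agree with the limit as soon as `t < σ k`.
  refine ⟨martingale_of_tendsto_of_bounded hZ
    (fun k => martingale_stoppedProcess (hM k) (hMrc k) hκ) n (fun k t => ?_) (fun t => ?_), ?_⟩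
  · filter_upwards [hbound] with ω hω
    rw [hMκ]
    by_cases h : ω ∈ {ω | ⊥ < σ k ω}
    · rw [indicator_of_mem h]
      exact hω t _ (min_le_left _ _)
    · rw [indicator_of_notMem h, norm_zero]
      exact Nat.cast_nonneg _
  · filter_upwards [hσ.tendsto_top] with ω hω
    refine tendsto_const_nhds.congr' ?_
    filter_upwards [(WithTop.tendsto_nhds_top_iff _).1 hω t] with k hk
    have hpos : ω ∈ {ω | ⊥ < σ k ω} := lt_of_le_of_lt bot_le hk
    rw [hMκ, indicator_of_mem hpos, min_comm (κ ω),
      ← min_assoc, min_eq_left hk.le]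
    rfl
  · refine uniformIntegrable_of_bounded n
      (fun t => ((hZ t).mono (canonicalFiltration.le t)).aestronglyMeasurable) fun t => ?_
    filter_upwards [hbound] with ω hω
    exact hω t _ le_rfl

end Original

/-- The defining relation of the h-transform, at stopping times which precede the passage over
some finite level. -/
def HasStoppedDensity (P Q : Measure PathSpace) : Prop :=
  ∀ n : ℕ, 1 ≤ n → ∀ (κ : PathSpace → WithTop ℝ≥0) (hκ : IsStoppingTime canonicalFiltration κ),
    (∀ ω, κ ω ≤ upTime n ω) → ∀ A : Set PathSpace, MeasurableSet[hκ.measurableSpace] A →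
      Q A = ∫⁻ ω in A, XAt κ ω ∂P

lemma IsHTransform.hasStoppedDensity {P Q : Measure PathSpace} [IsProbabilityMeasure P]
    (hQ : IsHTransform P Q) (hX : IsNonnegLocalMartingale X canonicalFiltration P)
    (hX0 : P {ω | X 0 ω = 1} = 1) : HasStoppedDensity P Q := fun _ hn κ hκ hle =>
  hQ.density κ hκ (isUIMartingaleStopped_of_le_upTime hX hX0 hn hκ hle)

lemma valueAt_eq_untopA (ω : ℝ≥0 → ℝ≥0∞) {a : WithTop ℝ≥0} (ha : a ≠ ⊤) :
    valueAt ω a = ω a.untopA := by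
  obtain ⟨c, rfl⟩ := WithTop.ne_top_iff_exists.1 ha
  rfl

/-- The bounded stopping time `min t κ`, as a stopping time of the canonical filtration. -/
lemma isStoppingTime_min {κ : PathSpace → WithTop ℝ≥0}
    (hκ : IsStoppingTime canonicalFiltration κ) (t : ℝ≥0) :
    IsStoppingTime canonicalFiltration fun ω => min (t : WithTop ℝ≥0) (κ ω) :=
  (isStoppingTime_const canonicalFiltration t).min hκ

lemma measurable_stoppedProcess_X {κ : PathSpace → WithTop ℝ≥0}
    (hκ : IsStoppingTime canonicalFiltration κ) (t : ℝ≥0) :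
    Measurable[(isStoppingTime_min hκ t).measurableSpace] (stoppedProcess X κ t) :=
  measurable_stoppedValue isStronglyProgressive_X (isStoppingTime_min hκ t)

lemma measurable_stoppedProcess_X' {κ : PathSpace → WithTop ℝ≥0}
    (hκ : IsStoppingTime canonicalFiltration κ) (t : ℝ≥0) : Measurable (stoppedProcess X κ t) :=
  (measurable_stoppedProcess_X hκ t).mono (isStoppingTime_min hκ t).measurableSpace_le le_rfl

/-! ### Change of measure up to a finite level -/

section Transform

variable {P Q : Measure PathSpace} {n : ℕ} {κ : PathSpace → WithTop ℝ≥0}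

lemma HasStoppedDensity.apply_min (hD : HasStoppedDensity P Q) (hn : 1 ≤ n)
    (hκ : IsStoppingTime canonicalFiltration κ) (hle : ∀ ω, κ ω ≤ upTime n ω) (t : ℝ≥0)
    {A : Set PathSpace} (hA : MeasurableSet[(isStoppingTime_min hκ t).measurableSpace] A) :
    Q A = ∫⁻ ω in A, stoppedProcess X κ t ω ∂P := by
  rw [hD n hn _ (isStoppingTime_min hκ t) (fun ω => (min_le_right _ _).trans (hle ω)) A hA]
  refine lintegral_congr fun ω => ?_
  exact valueAt_eq_untopA _ (ne_top_of_le_ne_top WithTop.coe_ne_top (min_le_left _ _))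

/-- Trimming both measures to the σ-algebra at `min t κ` turns the relation on events into an
equality of measures. -/
lemma HasStoppedDensity.lintegral (hD : HasStoppedDensity P Q) (hn : 1 ≤ n)
    (hκ : IsStoppingTime canonicalFiltration κ) (hle : ∀ ω, κ ω ≤ upTime n ω) (t : ℝ≥0)
    {f : PathSpace → ℝ≥0∞} (hf : Measurable[(isStoppingTime_min hκ t).measurableSpace] f) :
    ∫⁻ ω, f ω ∂Q = ∫⁻ ω, stoppedProcess X κ t ω * f ω ∂P := by
  have hm := (isStoppingTime_min hκ t).measurableSpace_le
  have htrim : Q.trim hm = (P.withDensity (stoppedProcess X κ t)).trim hm := by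
    refine @Measure.ext _ (isStoppingTime_min hκ t).measurableSpace _ _ fun A hA => ?_
    rw [trim_measurableSet_eq hm hA, trim_measurableSet_eq hm hA, withDensity_apply _ (hm _ hA)]
    exact hD.apply_min hn hκ hle t hA
  rw [← lintegral_trim hm hf, htrim, lintegral_trim hm hf,
    lintegral_withDensity_eq_lintegral_mul _ (measurable_stoppedProcess_X' hκ t)
      (hf.mono hm le_rfl)]
  rfl

/-- The factors `X` and `1 / X` cancel: `X` is nonzero on `B` and finite `P`-almost surely. -/
lemma HasStoppedDensity.setLIntegral_inv (hD : HasStoppedDensity P Q)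
    (hfin : ∀ᵐ ω ∂P, ∀ t, X t ω ≠ ∞) (hn : 1 ≤ n)
    (hκ : IsStoppingTime canonicalFiltration κ) (hle : ∀ ω, κ ω ≤ upTime n ω) (t : ℝ≥0)
    {B : Set PathSpace} (hB : MeasurableSet[(isStoppingTime_min hκ t).measurableSpace] B)
    (hpos : ∀ ω ∈ B, stoppedProcess X κ t ω ≠ 0) :
    ∫⁻ ω in B, (stoppedProcess X κ t ω)⁻¹ ∂Q = P B := by
  have hBm : MeasurableSet B := (isStoppingTime_min hκ t).measurableSpace_le _ hB
  have hf : Measurable[(isStoppingTime_min hκ t).measurableSpace]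
      (B.indicator fun ω => (stoppedProcess X κ t ω)⁻¹) :=
    (measurable_stoppedProcess_X hκ t).inv.indicator hB
  rw [← lintegral_indicator hBm, hD.lintegral hn hκ hle t hf, ← lintegral_indicator_one hBm]
  refine lintegral_congr_ae ?_
  filter_upwards [hfin] with ω hω
  by_cases h : ω ∈ B
  · rw [indicator_of_mem h, indicator_of_mem h]
    exact ENNReal.mul_inv_cancel (hpos ω h) (hω _)
  · rw [indicator_of_notMem h, indicator_of_notMem h, mul_zero]

/-! ### The reciprocal of the coordinate process -/

/-- The reciprocal of the coordinate process, set to zero on the paths that start at or below the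
level `a`. -/
def invX (a : ℝ≥0∞) (t : ℝ≥0) : PathSpace → ℝ :=
  {ω | ⊥ < downTime a ω}.indicator (fun ω => ((X t ω)⁻¹).toReal)

lemma stoppedProcess_invX (a : ℝ≥0∞) (κ : PathSpace → WithTop ℝ≥0) (t : ℝ≥0) :
    stoppedProcess (invX a) κ t =
      {ω | ⊥ < downTime a ω}.indicator fun ω => ((stoppedProcess X κ t ω)⁻¹).toReal := rfl

lemma measurableSet_bot_lt_downTime {a : ℝ≥0∞} (ha : a ≠ ∞) (t : ℝ≥0) :
    MeasurableSet[canonicalFiltration t] {ω | ⊥ < downTime a ω} := by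
  have h := (isStoppingTime_downTime ha 0).compl
  refine canonicalFiltration.mono (zero_le (a := t)) _ ?_
  convert h using 1
  ext ω
  simp only [mem_ofPred_eq, mem_compl_iff, not_le]
  rfl

lemma stronglyAdapted_stoppedProcess_invX {a : ℝ≥0∞} (ha : a ≠ ∞)
    (hκ : IsStoppingTime canonicalFiltration κ) :
    StronglyAdapted canonicalFiltration (stoppedProcess (invX a) κ) := fun t => by
  rw [stoppedProcess_invX]
  exact (stronglyAdapted_stoppedProcess_comp hκ (f := fun x => (x⁻¹).toReal) (by fun_prop) t).indicator
    (measurableSet_bot_lt_downTime ha t)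

lemma norm_stoppedProcess_invX_le {a : ℝ≥0∞} (ha : a ≠ 0) (hle : ∀ ω, κ ω ≤ downTime a ω)
    (t : ℝ≥0) (ω : PathSpace) : ‖(stoppedProcess (invX a) κ t) ω‖ ≤ (a⁻¹).toReal := by
  rw [stoppedProcess_invX]
  by_cases h : ω ∈ {ω | ⊥ < downTime a ω}
  · rw [indicator_of_mem h, Real.norm_of_nonneg ENNReal.toReal_nonneg]
    exact ENNReal.toReal_mono (ENNReal.inv_ne_top.2 ha)
      (ENNReal.inv_le_inv.2 (le_X_min_downTime h t (hle ω)))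
  · rw [indicator_of_notMem h, norm_zero]
    exact ENNReal.toReal_nonneg

/-- The bound by `upTime` gives access to the density, the bound by `downTime` keeps `1 / X`
bounded. The integrals to be compared are both the `P`-measure of one event, which does not involve
`t`. -/
lemma HasStoppedDensity.martingale_stoppedProcess_invX [IsFiniteMeasure Q]
    (hD : HasStoppedDensity P Q) (hfin : ∀ᵐ ω ∂P, ∀ t, X t ω ≠ ∞) (hn : 1 ≤ n) {a : ℝ≥0∞}
    (ha : a ≠ 0) (ha' : a ≠ ∞) (hκ : IsStoppingTime canonicalFiltration κ)
    (hup : ∀ ω, κ ω ≤ upTime n ω) (hdown : ∀ ω, κ ω ≤ downTime a ω) :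
    Martingale (stoppedProcess (invX a) κ) canonicalFiltration Q := by
  have hZ := stronglyAdapted_stoppedProcess_invX ha' hκ
  have hint : ∀ t, Integrable (stoppedProcess (invX a) κ t) Q := fun t =>
    Integrable.of_bound ((hZ t).mono (canonicalFiltration.le t)).aestronglyMeasurable _
      (Eventually.of_forall (norm_stoppedProcess_invX_le ha hdown t))
  refine martingale_of_setIntegral_eq hZ hint fun s t hst A hA =>
    setIntegral_stoppedProcess_eq hκ hint hst hA ?_
  have key : ∀ t, s ≤ t → ∫ ω in A ∩ {ω | s ≤ κ ω}, stoppedProcess (invX a) κ t ω ∂Q =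
      (P ((A ∩ {ω | ⊥ < downTime a ω}) ∩ {ω | s ≤ κ ω})).toReal := by
    intro t hst
    have hB := measurableSet_inter_const_le hκ hst
      (hA.inter (measurableSet_bot_lt_downTime ha' s))
    have hBm := (isStoppingTime_min hκ t).measurableSpace_le _ hB
    have hpos : ∀ ω ∈ (A ∩ {ω | ⊥ < downTime a ω}) ∩ {ω | s ≤ κ ω},
        stoppedProcess X κ t ω ≠ 0 := fun ω hω =>
      (lt_of_lt_of_le (pos_iff_ne_zero.2 ha) (le_X_min_downTime hω.1.2 t (hdown ω))).ne'
    have hmeas : Measurable fun ω => (stoppedProcess X κ t ω)⁻¹ :=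
      (measurable_stoppedProcess_X' hκ t).inv
    rw [stoppedProcess_invX,
      setIntegral_indicator (canonicalFiltration.le s _ (measurableSet_bot_lt_downTime ha' s)),
      inter_right_comm, integral_toReal hmeas.aemeasurable
        (ae_restrict_of_forall_mem hBm fun ω hω => ENNReal.inv_lt_top.2
          (pos_iff_ne_zero.2 (hpos ω hω))),
      hD.setLIntegral_inv hfin hn hκ hup t hB hpos]
  rw [key t hst, key s le_rfl]

/-- As the level tends to infinity, the coordinate process stopped at the passage over that level
converges. -/
lemma tendsto_stoppedProcess_min_upTime (ρ : PathSpace → WithTop ℝ≥0) (t : ℝ≥0) (ω : PathSpace) :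
    Tendsto (fun n : ℕ => stoppedProcess X (fun ω => min (ρ ω) (upTime ((n + 1 : ℕ) : ℝ≥0∞) ω)) t ω)
      atTop (𝓝 (stoppedProcess X ρ t ω)) := by
  set r := (min (t : WithTop ℝ≥0) (ρ ω)).untopA with hr
  have hval : ∀ n : ℕ, stoppedProcess X (fun ω => min (ρ ω) (upTime ((n + 1 : ℕ) : ℝ≥0∞) ω)) t ω =
      X (min (r : WithTop ℝ≥0) (upTime ((n + 1 : ℕ) : ℝ≥0∞) ω)).untopA ω := by
    intro n
    rw [hr, coe_untopA_min, min_assoc]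
    rfl
  simp_rw [hval]
  change Tendsto _ _ (𝓝 (X r ω))
  by_cases hX : X r ω = ∞
  · rw [hX]
    -- If the value at `r` is infinite, level `n + 1` is passed by time `r` and the stopped value is
    -- at least `n + 1`.
    refine tendsto_nhds_top_mono ENNReal.tendsto_nat_nhds_top (Eventually.of_forall fun n => ?_)
    have h1 : upTime ((n + 1 : ℕ) : ℝ≥0∞) ω ≤ r := upTime_le_of_le (by rw [hX]; exact le_top)
    obtain ⟨s, hs⟩ := WithTop.ne_top_iff_exists.1 (ne_top_of_le_ne_top WithTop.coe_ne_top h1)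
    have h2 := le_X_of_upTime_eq hs.symm
    beta_reduce
    rw [min_eq_right h1, ← hs]
    refine le_trans ?_ h2
    exact_mod_cast n.le_succ
  · refine tendsto_const_nhds.congr' ?_
    filter_upwards [(tendsto_add_atTop_nat 1).eventually (eventually_lt_upTime hX)] with n hn
    rw [min_eq_left hn.le]
    rfl

lemma HasStoppedDensity.martingale_stoppedProcess_invX_downTime [IsFiniteMeasure Q]
    (hD : HasStoppedDensity P Q) (hfin : ∀ᵐ ω ∂P, ∀ t, X t ω ≠ ∞) {a : ℝ≥0∞}
    (ha : a ≠ 0) (ha' : a ≠ ∞) :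
    Martingale (stoppedProcess (invX a) (downTime a)) canonicalFiltration Q := by
  have hdown := isStoppingTime_downTime ha'
  refine martingale_of_tendsto_of_bounded
    (Zn := fun n => stoppedProcess (invX a)
      fun ω => min (downTime a ω) (upTime ((n + 1 : ℕ) : ℝ≥0∞) ω))
    (stronglyAdapted_stoppedProcess_invX ha' hdown) (fun n => ?_) ((a⁻¹).toReal)
    (fun n t => Eventually.of_forall ?_) (fun t => Eventually.of_forall fun ω => ?_)
  · exact hD.martingale_stoppedProcess_invX hfin (Nat.le_add_left 1 n) ha ha'
      (hdown.min (isStoppingTime_upTime _)) (fun ω => min_le_right _ _) (fun ω => min_le_left _ _)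
  · exact norm_stoppedProcess_invX_le ha (fun ω => min_le_left _ _) t
  · simp_rw [stoppedProcess_invX]
    by_cases h : ω ∈ {ω | ⊥ < downTime a ω}
    · simp_rw [indicator_of_mem h]
      have hne : (stoppedProcess X (downTime a) t ω)⁻¹ ≠ ∞ := ENNReal.inv_ne_top.2
        (lt_of_lt_of_le (pos_iff_ne_zero.2 ha) (le_X_min_downTime h t le_rfl)).ne'
      exact (ENNReal.continuousAt_toReal hne).tendsto.comp
        ((continuous_inv.tendsto _).comp (tendsto_stoppedProcess_min_upTime (downTime a) t ω))
    · simp_rw [indicator_of_notMem h]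
      exact tendsto_const_nhds

end Transform

section Transform

variable {P Q : Measure PathSpace}

/-! ### Maximal inequalities -/

/-- If the coordinate process is at most `a` at the stopping time `η`, then the probability that
`η` is finite is at most `a` times the one under the original measure. -/
lemma HasStoppedDensity.apply_ne_top_le (hD : HasStoppedDensity P Q)
    {η : PathSpace → WithTop ℝ≥0} (hη : IsStoppingTime canonicalFiltration η) {a : ℝ≥0∞}
    (ha : a ≠ ∞) (hle : ∀ ω (s : ℝ≥0), η ω = s → X s ω ≤ a) :
    Q {ω | η ω ≠ ⊤} ≤ a * P {ω | η ω ≠ ⊤} := by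
  let up : ℕ → PathSpace → WithTop ℝ≥0 := fun n => upTime ((n + 1 : ℕ) : ℝ≥0∞)
  have hup : ∀ n, IsStoppingTime canonicalFiltration (up n) := fun n => isStoppingTime_upTime _
  -- The cut-offs place `B n` in a σ-algebra to which the density relation applies; on `B n` the
  -- stopped value is the value at `η`, which is at most `a`.
  let B : ℕ → Set PathSpace := fun n => {ω | η ω ≤ min (((n : ℝ≥0) : WithTop ℝ≥0)) (up n ω)}
  have hB : ∀ n, Q (B n) ≤ a * P {ω | η ω ≠ ⊤} := by
    intro n
    have hκ := hη.min (hup n)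
    have hBm : MeasurableSet[(isStoppingTime_min hκ n).measurableSpace] (B n) := by
      refine IsStoppingTime.measurableSpace_mono _ _ (fun ω => ?_) _
        (hη.measurableSet_stopping_time_le_min (isStoppingTime_min (hup n) n))
      exact le_min ((min_le_right _ _).trans (min_le_left _ _))
        (le_min (min_le_left _ _) ((min_le_right _ _).trans (min_le_right _ _)))
    rw [hD.apply_min (Nat.le_add_left 1 n) hκ (fun ω => min_le_right _ _) n hBm]
    calc ∫⁻ ω in B n, stoppedProcess X (fun ω => min (η ω) (up n ω)) n ω ∂P
        ≤ ∫⁻ _ in B n, a ∂P := by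
          refine setLIntegral_mono' ((isStoppingTime_min hκ n).measurableSpace_le _ hBm)
            fun ω hω => ?_
          have hω1 : η ω ≤ ((n : ℝ≥0) : WithTop ℝ≥0) := hω.trans (min_le_left _ _)
          have hω2 : η ω ≤ up n ω := hω.trans (min_le_right _ _)
          obtain ⟨s, hs⟩ := WithTop.ne_top_iff_exists.1
            (ne_top_of_le_ne_top WithTop.coe_ne_top hω1)
          rw [stoppedProcess, min_eq_left hω2, min_eq_right hω1, ← hs]
          exact hle ω s hs.symm
      _ = a * P (B n) := by rw [setLIntegral_const]
      _ ≤ a * P {ω | η ω ≠ ⊤} := by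
          gcongr
          intro ω hω
          exact ne_top_of_le_ne_top WithTop.coe_ne_top (hω.trans (min_le_left _ _))
  have hmono : Monotone B := fun i j hij ω hω => by
    refine le_trans hω (min_le_min ?_ (upTime_mono ω ?_))
    · exact_mod_cast hij
    · exact_mod_cast Nat.add_le_add_right hij 1
  have hsub : {ω | η ω ≠ ⊤} ⊆ ⋃ n, B n := by
    intro ω hω
    obtain ⟨s, hs⟩ := WithTop.ne_top_iff_exists.1 hω
    -- Being finite at time `η`, the path passes all sufficiently high levels only later.
    have hX : X s ω ≠ ∞ := ne_top_of_le_ne_top ha (hle ω s hs.symm)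
    obtain ⟨k, hk⟩ := exists_nat_ge s
    obtain ⟨n, hn1, hn2⟩ := (((tendsto_add_atTop_nat 1).eventually (eventually_lt_upTime hX)).and
      (eventually_ge_atTop k)).exists
    refine mem_iUnion.2 ⟨n, show η ω ≤ min _ (up n ω) from le_min ?_ ?_⟩
    · rw [← hs]
      have : (k : ℝ≥0) ≤ n := by exact_mod_cast hn2
      exact WithTop.coe_le_coe.2 (hk.trans this)
    · rw [← hs]
      exact hn1.le
  calc Q {ω | η ω ≠ ⊤} ≤ Q (⋃ n, B n) := measure_mono hsub
    _ = ⨆ n, Q (B n) := hmono.measure_iUnion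
    _ ≤ a * P {ω | η ω ≠ ⊤} := iSup_le hB

lemma measurableSet_ne_top {κ : PathSpace → WithTop ℝ≥0}
    (hκ : IsStoppingTime canonicalFiltration κ) :
    MeasurableSet[hκ.measurableSpace] {ω | κ ω ≠ ⊤} :=
  hκ.measurable (measurableSet_singleton ⊤).compl

/-- The density is at least `n` at the passage, so `n` times the `P`-measure is at most a
`Q`-measure, hence at most one. -/
lemma HasStoppedDensity.upTime_ne_top_le [IsProbabilityMeasure Q] (hD : HasStoppedDensity P Q)
    {n : ℕ} (hn : 1 ≤ n) : P {ω | upTime n ω ≠ ⊤} ≤ (n : ℝ≥0∞)⁻¹ := by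
  have hup := isStoppingTime_upTime (n : ℝ≥0∞)
  have hA := measurableSet_ne_top hup
  have h1 : (n : ℝ≥0∞) * P {ω | upTime n ω ≠ ⊤} ≤ 1 := by
    rw [← setLIntegral_const]
    refine le_trans ?_ (prob_le_one (μ := Q) (s := {ω | upTime n ω ≠ ⊤}))
    rw [hD n hn _ hup (fun _ => le_rfl) _ hA]
    refine setLIntegral_mono' (hup.measurableSpace_le _ hA) fun ω hω => ?_
    obtain ⟨s, hs⟩ := WithTop.ne_top_iff_exists.1 hω
    rw [XAt, ← hs]
    exact le_X_of_upTime_eq hs.symm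
  rw [← one_div, ENNReal.le_div_iff_mul_le (Or.inr one_ne_zero)
    (Or.inl (ENNReal.natCast_ne_top n)), mul_comm]
  exact h1

lemma HasStoppedDensity.downTime_ne_top_le [IsProbabilityMeasure P] (hD : HasStoppedDensity P Q)
    {a : ℝ≥0∞} (ha : a ≠ ∞) : Q {ω | downTime a ω ≠ ⊤} ≤ a := by
  refine (hD.apply_ne_top_le (isStoppingTime_downTime ha) ha
    fun ω s hs => X_le_of_downTime_eq hs).trans ?_
  calc a * P {ω | downTime a ω ≠ ⊤} ≤ a * 1 := by gcongr; exact prob_le_one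
    _ = a := mul_one a

/-- The exceptional set lies in `{downTime a ≠ ⊤}` for every `a = 1 / (m + 1)`, so its `Q`-measure
is at most each such `a`. -/
lemma HasStoppedDensity.ae_exists_downTime_eq_top [IsProbabilityMeasure P]
    (hD : HasStoppedDensity P Q) : ∀ᵐ ω ∂Q, ∃ m : ℕ, downTime ((m : ℝ≥0∞) + 1)⁻¹ ω = ⊤ := by
  rw [ae_iff]
  simp only [not_exists]
  have hlim : Tendsto (fun m : ℕ => ((m : ℝ≥0∞) + 1)⁻¹) atTop (𝓝 0) := by
    have := ENNReal.tendsto_inv_nat_nhds_zero.comp (tendsto_add_atTop_nat 1)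
    refine this.congr fun m => ?_
    simp
  refine le_antisymm (ge_of_tendsto' hlim fun m => ?_) zero_le
  refine (measure_mono fun ω hω => ?_).trans (hD.downTime_ne_top_le (a := ((m : ℝ≥0∞) + 1)⁻¹) ?_)
  · exact hω m
  · exact ENNReal.inv_ne_top.2 (by positivity)

/-- Under the transformed measure the coordinate process does not jump to infinity. -/
lemma HasStoppedDensity.ae_X_upTime_ne_top (hD : HasStoppedDensity P Q)
    (hfin : ∀ᵐ ω ∂P, ∀ t, X t ω ≠ ∞) :
    ∀ᵐ ω ∂Q, ∀ n : ℕ, 1 ≤ n → ∀ s : ℝ≥0, upTime n ω = s → X s ω ≠ ∞ := by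
  have key : ∀ n : ℕ, 1 ≤ n → ∀ k : ℕ, ∀ᵐ ω ∂Q, stoppedProcess X (upTime n) k ω ≠ ∞ := by
    intro n hn k
    have hup := isStoppingTime_upTime (n : ℝ≥0∞)
    have hB : MeasurableSet[(isStoppingTime_min hup k).measurableSpace]
        {ω | stoppedProcess X (upTime n) k ω = ∞} :=
      measurable_stoppedProcess_X hup k (measurableSet_singleton ∞)
    rw [ae_iff]
    simp only [not_not]
    rw [hD.apply_min hn hup (fun _ => le_rfl) k hB]
    refine setLIntegral_measure_zero _ _ ?_
    refine measure_mono_null (fun ω hω => ?_) (ae_iff.1 hfin)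
    exact fun h => h _ hω
  filter_upwards [ae_all_iff.2 fun n => ae_all_iff.2 fun hn => ae_all_iff.2 (key n hn)]
    with ω hω n hn s hs
  obtain ⟨k, hk⟩ := exists_nat_ge s
  have := hω n hn k
  rw [stoppedProcess_eq_of_ge (by rw [hs]; exact WithTop.coe_le_coe.2 hk), hs] at this
  exact this

/-- For a finite set of times, the first one after the passage over the level `b` at which the
coordinate process is at most `a`. -/
lemma exists_isStoppingTime_finset (a b : ℝ≥0∞) (F : Finset ℝ≥0) :
    ∃ η : PathSpace → WithTop ℝ≥0, IsStoppingTime canonicalFiltration η ∧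
      (∀ ω (s : ℝ≥0), η ω = s → upTime b ω ≤ s ∧ X s ω ≤ a) ∧
      ∀ ω, ∀ u ∈ F, upTime b ω ≤ u → X u ω ≤ a → η ω ≤ u := by
  classical
  induction F using Finset.induction_on with
  | empty =>
    refine ⟨fun _ => ⊤, fun i => ?_, fun ω s h => absurd h WithTop.top_ne_coe, by simp⟩
    simp
  | insert u F _ ih =>
    obtain ⟨η, hη, h1, h2⟩ := ih
    let θ : PathSpace → WithTop ℝ≥0 := fun ω => if upTime b ω ≤ u ∧ X u ω ≤ a then u else ⊤
    have hθ : IsStoppingTime canonicalFiltration θ := by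
      intro i
      by_cases hui : u ≤ i
      · have : {ω | θ ω ≤ i} = {ω | upTime b ω ≤ u} ∩ {ω | X u ω ≤ a} := by
          ext ω
          simp only [θ, mem_ofPred_eq, mem_inter_iff]
          split_ifs with h
          · exact iff_of_true (WithTop.coe_le_coe.2 hui) h
          · exact iff_of_false (not_le.2 (WithTop.coe_lt_top i)) h
        rw [this]
        exact (canonicalFiltration.mono hui _ (isStoppingTime_upTime b u)).inter
          (measurable_X hui measurableSet_Iic)
      · convert MeasurableSet.empty
        ext ω
        simp only [θ, mem_ofPred_eq, mem_empty_iff_false, iff_false]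
        split_ifs with h
        · exact fun hle => hui (WithTop.coe_le_coe.1 hle)
        · exact not_le.2 (WithTop.coe_lt_top i)
    refine ⟨fun ω => min (η ω) (θ ω), hη.min hθ, fun ω s hs => ?_, fun ω v hv hvb hva => ?_⟩
    · rcases min_choice (η ω) (θ ω) with h | h
      · exact h1 ω s (h.symm.trans hs)
      · have hθs : θ ω = s := h.symm.trans hs
        simp only [θ] at hθs
        split_ifs at hθs with hu
        · have : u = s := WithTop.coe_injective hθs
          rwa [← this]
        · exact absurd hθs WithTop.top_ne_coe
    · rcases Finset.mem_insert.1 hv with rfl | hv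
      · refine (min_le_right _ _).trans ?_
        exact (if_pos ⟨hvb, hva⟩).le
      · exact (min_le_left _ _).trans (h2 ω v hv hvb hva)

/-- After passing a high level, the coordinate process returns to a low level with small
probability. -/
lemma HasStoppedDensity.apply_exists_le [IsProbabilityMeasure Q] (hD : HasStoppedDensity P Q)
    {n : ℕ} (hn : 1 ≤ n) {a : ℝ≥0∞} (ha : a ≠ ∞) (d : ℕ → ℝ≥0) :
    Q {ω | ∃ j, upTime n ω ≤ d j ∧ X (d j) ω ≤ a} ≤ a * (n : ℝ≥0∞)⁻¹ := by
  classical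
  -- Over finitely many times the first return is evidently a stopping time; a monotone limit then
  -- recovers the whole sequence.
  let E : ℕ → Set PathSpace := fun N => {ω | ∃ j < N, upTime n ω ≤ d j ∧ X (d j) ω ≤ a}
  have hE : {ω | ∃ j, upTime n ω ≤ d j ∧ X (d j) ω ≤ a} = ⋃ N, E N := by
    ext ω
    simp only [E, mem_ofPred_eq, mem_iUnion]
    exact ⟨fun ⟨j, hj⟩ => ⟨j + 1, j, j.lt_succ_self, hj⟩, fun ⟨_, j, _, hj⟩ => ⟨j, hj⟩⟩
  have hmono : Monotone E := fun N M hNM ω ⟨j, hj, h⟩ => ⟨j, hj.trans_le hNM, h⟩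
  rw [hE, hmono.measure_iUnion]
  refine iSup_le fun N => ?_
  obtain ⟨η, hη, h1, h2⟩ := exists_isStoppingTime_finset a n ((Finset.range N).image d)
  calc Q (E N) ≤ Q {ω | η ω ≠ ⊤} := by
        refine measure_mono ?_
        rintro ω ⟨j, hj, hup, hX⟩
        exact ne_top_of_le_ne_top WithTop.coe_ne_top
          (h2 ω (d j) (Finset.mem_image_of_mem d (Finset.mem_range.2 hj)) hup hX)
    _ ≤ a * P {ω | η ω ≠ ⊤} := hD.apply_ne_top_le hη ha fun ω s hs => (h1 ω s hs).2
    _ ≤ a * P {ω | upTime n ω ≠ ⊤} := by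
        refine mul_le_mul_right (measure_mono fun ω hω => ?_) a
        obtain ⟨s, hs⟩ := WithTop.ne_top_iff_exists.1 hω
        exact ne_top_of_le_ne_top WithTop.coe_ne_top (h1 ω s hs.symm).1
    _ ≤ a * (n : ℝ≥0∞)⁻¹ := by
        gcongr
        exact hD.upTime_ne_top_le hn

/-- Under the transformed measure, for every level there is a higher level such that the coordinate
process does not go below the former one after passing the latter one. -/
lemma HasStoppedDensity.ae_exists_forall_le [IsProbabilityMeasure Q] (hD : HasStoppedDensity P Q) :
    ∀ᵐ ω ∂Q, ∀ k : ℕ, ∃ n : ℕ, 1 ≤ n ∧ ∀ u : ℝ≥0, upTime n ω < u → (k : ℝ≥0∞) ≤ X u ω := by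
  let d := TopologicalSpace.denseSeq ℝ≥0
  have hd : DenseRange d := TopologicalSpace.denseRange_denseSeq ℝ≥0
  have key : ∀ k : ℕ, ∀ᵐ ω ∂Q, ∃ n : ℕ, 1 ≤ n ∧
      ¬ ∃ j, upTime n ω ≤ d j ∧ X (d j) ω ≤ k := by
    intro k
    rw [ae_iff]
    have hlim : Tendsto (fun n : ℕ => (k : ℝ≥0∞) * (n : ℝ≥0∞)⁻¹) atTop (𝓝 0) := by
      have := ENNReal.Tendsto.const_mul ENNReal.tendsto_inv_nat_nhds_zero
        (Or.inr (ENNReal.natCast_ne_top k))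
      rwa [mul_zero] at this
    refine le_antisymm (ge_of_tendsto hlim ?_) zero_le
    filter_upwards [eventually_ge_atTop 1] with n hn
    refine (measure_mono fun ω hω => ?_).trans
      (hD.apply_exists_le hn (ENNReal.natCast_ne_top k) d)
    by_contra hcon
    exact hω ⟨n, hn, hcon⟩
  filter_upwards [ae_all_iff.2 key] with ω hω k
  obtain ⟨n, hn, h⟩ := hω k
  refine ⟨n, hn, fun u hu => ?_⟩
  by_contra hlt
  rw [not_le] at hlt
  obtain ⟨s, hs⟩ := WithTop.ne_top_iff_exists.1 (ne_top_of_lt hu)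
  rw [← hs, WithTop.coe_lt_coe] at hu
  -- A value below `k` is finite, so by continuity at `u` the path is also below `k` at some time of
  -- the dense sequence after the passage.
  have hc : ContinuousAt ω.1 u := ω.2.continuousAt (ne_top_of_lt hlt)
  obtain ⟨V, hV, hVo, huV⟩ := mem_nhds_iff.1
    (inter_mem (hc.eventually (gt_mem_nhds hlt)) (Ioi_mem_nhds hu))
  obtain ⟨j, hj⟩ := hd.exists_mem_open hVo ⟨u, huV⟩
  refine h ⟨j, ?_, (hV hj).1.le⟩
  rw [← hs]
  exact WithTop.coe_le_coe.2 (le_of_lt (hV hj).2)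

/-! ### Path properties under the transformed measure -/

/-- Only a time `t` with infinite value is at issue. A level is passed strictly before `t`, since
the value at the passage is finite; if the level is high enough, the process stays above `k`
afterwards. -/
lemma HasStoppedDensity.ae_continuous [IsProbabilityMeasure Q] (hD : HasStoppedDensity P Q)
    (hfin : ∀ᵐ ω ∂P, ∀ t, X t ω ≠ ∞) : ∀ᵐ ω ∂Q, Continuous fun t => X t ω := by
  filter_upwards [hD.ae_X_upTime_ne_top hfin, hD.ae_exists_forall_le] with ω h1 h2
  refine continuous_iff_continuousAt.2 fun t => ?_
  by_cases ht : X t ω = ∞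
  · rw [ContinuousAt, ht, ENNReal.tendsto_nhds_top_iff_nat]
    intro k
    obtain ⟨n, hn, hk⟩ := h2 (k + 1)
    have hle : upTime n ω ≤ t := upTime_le_of_le (by rw [ht]; exact le_top)
    have hlt : upTime n ω < t := by
      refine lt_of_le_of_ne hle fun h => ?_
      exact h1 n hn t h ht
    obtain ⟨s, hs⟩ := WithTop.ne_top_iff_exists.1 (ne_top_of_lt hlt)
    rw [← hs, WithTop.coe_lt_coe] at hlt
    filter_upwards [Ioi_mem_nhds hlt] with u hu
    have hku := hk u (by rw [← hs]; exact WithTop.coe_lt_coe.2 hu)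
    refine lt_of_lt_of_le ?_ hku
    exact_mod_cast k.lt_succ_self
  · exact ω.2.continuousAt ht

/-- If all levels are passed, the absence of returns forces `X` to tend to `∞`, so the terminal
value is infinite. -/
lemma HasStoppedDensity.ae_hittingTime_eq_top_iff [IsProbabilityMeasure Q]
    (hD : HasStoppedDensity P Q) :
    ∀ᵐ ω ∂Q, T ∞ ω = ⊤ ↔ ∃ n : ℕ, upTime ((n + 1 : ℕ) : ℝ≥0∞) ω = ⊤ := by
  filter_upwards [hD.ae_exists_forall_le] with ω hω
  rw [T, hittingTime_top_eq_top_iff]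
  constructor
  · rintro ⟨-, h2⟩
    by_contra hcon
    push Not at hcon
    have hlim : Tendsto (fun t => ω.1 t) atTop (𝓝 ∞) := by
      refine ENNReal.tendsto_nhds_top_iff_nat.2 fun k => ?_
      obtain ⟨n, hn, hk⟩ := hω (k + 1)
      obtain ⟨m, rfl⟩ := Nat.exists_eq_add_of_le' hn
      obtain ⟨s, hs⟩ := WithTop.ne_top_iff_exists.1 (hcon m)
      filter_upwards [eventually_gt_atTop s] with u hu
      have hku := hk u (by rw [← hs]; exact WithTop.coe_lt_coe.2 hu)
      refine lt_of_lt_of_le ?_ hku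
      exact_mod_cast k.lt_succ_self
    refine h2 ?_
    rw [terminalValue, hlim.limsup_eq, hlim.liminf_eq]
    simp
  · rintro ⟨n, hn⟩
    have hlt : ∀ t, ω.1 t ≤ ((n + 1 : ℕ) : ℝ≥0∞) := fun t => (upTime_eq_top_iff.1 hn t).le
    have hls : limsup ω.1 atTop ≤ ((n + 1 : ℕ) : ℝ≥0∞) :=
      limsup_le_of_le (by isBoundedDefault) (Eventually.of_forall hlt)
    have hls' : limsup ω.1 atTop ≠ ∞ := ne_top_of_le_ne_top (ENNReal.natCast_ne_top _) hls
    have hli : liminf ω.1 atTop ≠ ∞ := ne_top_of_le_ne_top hls' (liminf_le_limsup)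
    refine ⟨fun t => ne_top_of_le_ne_top (ENNReal.natCast_ne_top _) (hlt t), ?_⟩
    rw [terminalValue, if_neg fun h => hls' h.1]
    exact ENNReal.rpow_ne_top_of_nonneg (by norm_num) (ENNReal.mul_ne_top hls' hli)

/-! ### The main results -/

theorem HasStoppedDensity.isNonnegLocalMartingale_inv [IsProbabilityMeasure P]
    [IsProbabilityMeasure Q] (hD : HasStoppedDensity P Q) (hfin : ∀ᵐ ω ∂P, ∀ t, X t ω ≠ ∞) :
    IsNonnegLocalMartingale (fun t ω => (X t ω)⁻¹) canonicalFiltration Q := by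
  have hpos : ∀ᵐ ω ∂Q, ∀ t, (X t ω)⁻¹ ≠ ∞ := by
    filter_upwards [hD.ae_exists_downTime_eq_top] with ω ⟨m, hm⟩ t
    exact ENNReal.inv_ne_top.2 (bot_le.trans_lt (downTime_eq_top_iff.1 hm t)).ne'
  -- The indicator in `invX` matches the one in `Locally`. It matters already for `m = 0`, where the
  -- level is `1` and paths starting at `1` are stopped at time zero.
  refine ⟨hpos, ?_, fun m => downTime ((m : ℝ≥0∞) + 1)⁻¹, ⟨⟨fun m => ?_, ?_⟩, ?_⟩, fun m => ?_⟩
  · filter_upwards [hpos, hD.ae_continuous hfin] with ω h1 h2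
    have hc : Continuous fun t => ((X t ω)⁻¹).toReal := continuous_iff_continuousAt.2 fun t =>
      (ENNReal.continuousAt_toReal (h1 t)).comp (f := fun t => (X t ω)⁻¹)
        (continuous_inv.comp h2).continuousAt
    exact fun t => ⟨hc.continuousWithinAt, _, hc.continuousAt.continuousWithinAt⟩
  · exact isStoppingTime_downTime (ENNReal.inv_ne_top.2 (by positivity))
  · filter_upwards [hD.ae_exists_downTime_eq_top] with ω ⟨m, hm⟩
    refine tendsto_const_nhds.congr' ?_
    filter_upwards [eventually_ge_atTop m] with k hk
    refine (top_le_iff.1 (hm.symm.le.trans (downTime_anti ω ?_))).symm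
    gcongr
  · refine Eventually.of_forall fun ω i j hij => downTime_anti ω ?_
    gcongr
  · exact hD.martingale_stoppedProcess_invX_downTime hfin (ENNReal.inv_ne_zero.2 (by finiteness))
      (ENNReal.inv_ne_top.2 (by positivity))

theorem HasStoppedDensity.apply_hittingTime_eq_top [IsProbabilityMeasure P]
    [IsProbabilityMeasure Q] (hD : HasStoppedDensity P Q) :
    Q {ω | T ∞ ω = ⊤} = ∫⁻ ω, XInfty ω ∂P := by
  let B : ℕ → Set PathSpace := fun n => {ω | upTime ((n + 1 : ℕ) : ℝ≥0∞) ω = ⊤}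
  have hmono : Monotone B := fun i j hij ω hω => by
    refine top_le_iff.1 ((show upTime ((i + 1 : ℕ) : ℝ≥0∞) ω = ⊤ from hω).symm.le.trans
      (upTime_mono ω ?_))
    exact_mod_cast Nat.add_le_add_right hij 1
  have hQB : ∀ n, Q (B n) = ∫⁻ ω in B n, XInfty ω ∂P := by
    intro n
    have hup := isStoppingTime_upTime ((n + 1 : ℕ) : ℝ≥0∞)
    have hBm : MeasurableSet[hup.measurableSpace] (B n) :=
      hup.measurable (measurableSet_singleton ⊤)
    rw [hD (n + 1) (Nat.le_add_left 1 n) _ hup (fun _ => le_rfl) _ hBm]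
    -- On `B n` the passage time is `⊤`, so the density is the terminal value.
    refine setLIntegral_congr_fun (hup.measurableSpace_le _ hBm) fun ω hω => ?_
    rw [XAt, show upTime ((n + 1 : ℕ) : ℝ≥0∞) ω = ⊤ from hω]
    rfl
  have hPB : (⋃ n, B n : Set PathSpace) =ᵐ[P] univ := by
    refine eventuallyEq_univ.2 (mem_ae_iff.2 ?_)
    have hlim := ENNReal.tendsto_inv_nat_nhds_zero.comp (tendsto_add_atTop_nat 1)
    refine le_antisymm (ge_of_tendsto' hlim fun n => ?_) zero_le
    refine (measure_mono fun ω hω => ?_).trans (hD.upTime_ne_top_le (Nat.le_add_left 1 n))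
    exact fun h => hω (mem_iUnion.2 ⟨n, h⟩)
  calc Q {ω | T ∞ ω = ⊤} = Q (⋃ n, B n) := by
        refine measure_congr ?_
        filter_upwards [hD.ae_hittingTime_eq_top_iff] with ω hω
        refine propext (hω.trans ?_)
        exact (mem_iUnion (s := B) (x := ω)).symm
    _ = ⨆ n, ∫⁻ ω in B n, XInfty ω ∂P := by
        rw [hmono.measure_iUnion]
        exact iSup_congr hQB
    _ = ∫⁻ ω in ⋃ n, B n, XInfty ω ∂P :=
        (setLIntegral_iUnion_of_directed _ hmono.directed_le).symm
    _ = ∫⁻ ω, XInfty ω ∂P := by rw [Measure.restrict_congr_set hPB, Measure.restrict_univ]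

end Transform

end HTransform

end

theorem lemma2 (P : Measure HTransform.PathSpace) [IsProbabilityMeasure P]
    (hX : HTransform.IsNonnegLocalMartingale HTransform.X HTransform.canonicalFiltration P)
    (hX0 : P {ω | HTransform.X 0 ω = 1} = 1)
    (Q : Measure HTransform.PathSpace) (hQ : HTransform.IsHTransform P Q) :
    HTransform.IsNonnegLocalMartingale (fun t ω => (HTransform.X t ω)⁻¹)
        HTransform.canonicalFiltration Q ∧
      Q {ω | HTransform.T ∞ ω = ⊤} = ∫⁻ ω, HTransform.XInfty ω ∂P := by
  have := hQ.isProbabilityMeasure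
  have hD := hQ.hasStoppedDensity hX hX0
  exact ⟨hD.isNonnegLocalMartingale_inv hX.finite, hD.apply_hittingTime_eq_top⟩
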